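/- **Theorem 2 (Upper Bound).** Fix $\beta\in(0,1)$, an amplitude bound $U$, an exponent $0<q<\infty$, a precision $Q\in\mathbb N$ (a constant number of bits), a constant $c>0$, and a lattice $\Lambda\subset\mathbb R^2$ that spans $\mathbb R^2$ and has packing radius at least $\rho>0$. Put $k=k(n)=\lfloor n^{1-\beta}\rfloor$. *Input.* For every $n$, the input vector $X\in\mathbb R^n$ is random, has exactly $k$ non-zero entries, whose set of positions is uniformly distributed among the $k$-subsets of $\{1,\dots,n\}$, and satisfies $|X_i|\le U$ for all $i$; the law of the non-zero values is otherwise arbitrary, and may depend on the positions. The non-zero entries do not degenerate as $n\to\infty$: $\Pr\big[\sum_i|X_i|^q<ck\big]=\mathcal O(1/\sqrt k)$. *Circuits.* A decoding circuit for a matrix $\mathcal A\in\mathbb C^{m\times n}$ has $m$ input-nodes and $n$ output-nodes at distinct points of $\Lambda\cap V$, where $V\subset\mathbb R^2$ is compact. The $i$-th input-node stores the $i$-th entry of $Y=\mathcal A X$. Each ordered pair of nodes has a link, used once, in a time slot fixed in advance; it then carries a binary string, computed by the sender from its stored entry and the strings it received in earlier slots, the empty string meaning silence. Finally the $j$-th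 output-node computes $\hat X_j$ from the strings it received, with $\hat X_j=0$ if it received nothing. The bit-meters $\mu(DecCkt)$ is the sum over all unordered pairs of nodes of the number of bits communicated between them (in both directions) times their Euclidean distance, in the worst case over all data $y\in\mathbb C^m$ stored in the input-nodes. The average block error probability is $P_e=\Pr\big[\|X-\hat X\|_{\ell_q}/\|X\|_{\ell_q}>2^{-Q}\big]$. Then for all $n$ there exist $m=m(n)$, an encoding matrix $\mathcal A_n\in\mathbb C^{m\times n}$ and a decoding circuit $DecCkt_n$ on $\Lambda$, depending on the law of the input only through $\beta,U,q,c$, such that, as $n\to\infty$: 1. $P_e=\mathcal O(1/\sqrt k)$, for every sequence of input laws as above; 2. the number of measurements is $m=\Theta(k)$; 3. the precision is the given constant $Q$, i.e. $Q=\Theta(1)$; 4. $\mu(DecCkt_n)=\mathcal O(\sqrt{nk})$. -/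

import Mathlib

open Filter Asymptotics MeasureTheory
open scoped ENNReal Matrix

noncomputable section

/-- The plane `ℝ²` with its Euclidean distance. -/
abbrev Plane : Type := EuclideanSpace ℝ (Fin 2)

/-- A `ρ`-lattice: a subgroup of the plane that spans `ℝ²` and whose packing radius is at least `ρ`,
i.e. distinct points are at distance at least `2 * ρ`. -/
structure IsRhoLattice (ρ : ℝ) (Λ : AddSubgroup Plane) : Prop where
  span_eq_top : Submodule.span ℝ (Λ : Set Plane) = ⊤
  packing : ∀ x ∈ Λ, ∀ y ∈ Λ, x ≠ y → 2 * ρ ≤ dist x y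

/-- The sparsity `k = n ^ (1 - β)`, rounded down to an integer. -/
def sparsity (β : ℝ) (n : ℕ) : ℕ := ⌊(n : ℝ) ^ (1 - β)⌋₊

/-- `P` is the law of a random input vector of length `n` with exactly `k` non-zero entries, all
entries bounded by `U` in absolute value, and with support uniformly distributed among the
`k`-element subsets of the index set. The joint law of the non-zero values is arbitrary, and may
depend on the support. -/
structure IsSparseInput {n : ℕ} (k : ℕ) (U : ℝ) (P : Measure (Fin n → ℝ)) : Prop where
  isProbabilityMeasure : IsProbabilityMeasure P
  bounded : ∀ᵐ x ∂P, ∀ i, |x i| ≤ U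
  sparse : ∀ᵐ x ∂P, {i | x i ≠ 0}.ncard = k
  uniform : ∀ S : Finset (Fin n), S.card = k →
    P {x | ∀ i, x i ≠ 0 ↔ i ∈ S} = ((n.choose k : ℕ) : ℝ≥0∞)⁻¹

/-- The nodes of a decoding circuit: `m` input-nodes, each storing one entry of the output vector
`y = A x`, and `n` output-nodes, each producing one entry of the recovery vector. -/
abbrev CircuitNode (m n : ℕ) : Type := Fin m ⊕ Fin n

/-- A decoding circuit on the lattice `Λ`. The nodes sit at distinct points of the grid
`Λ ∩ substrate`. There is a link from every node to every other one. Each link is used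
once, in a time slot fixed in advance (so the instant of a transmission carries no information);
it then carries a binary string, computed by the sender from its stored entry and
the strings it has received in earlier slots. The empty string means silence. At the end every
output-node computes its entry of the recovery vector from the strings it has received, and
declares it to be zero when it has received nothing. -/
structure DecodingCircuit (Λ : AddSubgroup Plane) (m n : ℕ) where
  substrate : Set Plane
  isCompact_substrate : IsCompact substrate
  loc : CircuitNode m n → Plane
  loc_injective : Function.Injective loc
  loc_mem : ∀ v, loc v ∈ (Λ : Set Plane) ∩ substrate
  /-- The number of time slots. -/
  horizon : ℕ
  /-- The time slot of the link from the first node to the second. -/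
  slot : CircuitNode m n → CircuitNode m n → Fin horizon
  /-- `message v w s r` is the string that `v` sends to `w` when `v` stores `s` and has so far
  received the string `r u` from each node `u`. -/
  message : CircuitNode m n → CircuitNode m n → ℂ → (CircuitNode m n → List Bool) → List Bool
  /-- `recover j r` is the value declared by the output-node `j` after receiving the strings `r`. -/
  recover : Fin n → (CircuitNode m n → List Bool) → ℝ
  recover_silent : ∀ j, recover j (fun _ => []) = 0

namespace DecodingCircuit

variable {Λ : AddSubgroup Plane} {m n : ℕ}

/-- `transcript D y t v w` is the string sent from `v` to `w` during the first `t` time slots,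
when the input-nodes store `y` (output-nodes have nothing stored, encoded as `0`). -/
def transcript (D : DecodingCircuit Λ m n) (y : Fin m → ℂ) :
    ℕ → CircuitNode m n → CircuitNode m n → List Bool
  | 0 => fun _ _ => []
  | t + 1 => fun v w =>
      if (D.slot v w : ℕ) = t then
        D.message v w (Sum.elim y (fun _ => 0) v) (fun u => transcript D y t u v)
      else transcript D y t v w

/-- The recovery vector decoded from `y`. -/
def decode (D : DecodingCircuit Λ m n) (y : Fin m → ℂ) : Fin n → ℝ :=
  fun j => D.recover j (fun u => D.transcript y D.horizon u (Sum.inr j))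

/-- The number of bits communicated between `v` and `w` (in both directions) on the data `y`. -/
def bits (D : DecodingCircuit Λ m n) (y : Fin m → ℂ) (v w : CircuitNode m n) : ℕ :=
  (D.transcript y D.horizon v w).length + (D.transcript y D.horizon w v).length

/-- The bit-meters of a set `E` of nodes on the data `y`: the sum over pairs of nodes of the number
of bits communicated times the communication distance; each unordered pair occurs twice, whence
the division by `2`. -/
def bitMetersOn (D : DecodingCircuit Λ m n) (y : Fin m → ℂ) (E : Finset (CircuitNode m n)) : ℝ :=
  ∑ v ∈ E, ∑ w ∈ E, (D.bits y v w : ℝ) * dist (D.loc v) (D.loc w) / 2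

/-- The bit-meters of the circuit: those of the set of all nodes, in the worst case over the data
that the input-nodes may store. -/
def bitMeters (D : DecodingCircuit Λ m n) : ℝ≥0∞ :=
  ⨆ y : Fin m → ℂ, ENNReal.ofReal (D.bitMetersOn y Finset.univ)

end DecodingCircuit

/-- The output vector `A x` of the real input vector `x`. -/
def outputVector {m n : ℕ} (A : Matrix (Fin m) (Fin n) ℂ) (x : Fin n → ℝ) : Fin m → ℂ :=
  A *ᵥ (fun i => (x i : ℂ))

/-- The relative reconstruction error `‖x - z‖ / ‖x‖` in `ℓ_q`. -/
def relativeError {n : ℕ} (q : ℝ≥0∞) (x z : Fin n → ℝ) : ℝ :=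
  ‖WithLp.toLp q (x - z)‖ / ‖WithLp.toLp q x‖

/-- The average block error probability at precision `Q`: the probability, over the input vector,
that the relative error of the decoded vector exceeds `2 ^ (-Q)`. -/
def blockErrorProb {Λ : AddSubgroup Plane} {m n : ℕ} (q : ℝ≥0∞) (Q : ℕ)
    (P : Measure (Fin n → ℝ)) (A : Matrix (Fin m) (Fin n) ℂ) (D : DecodingCircuit Λ m n) : ℝ :=
  P.real {x | (2 : ℝ) ^ (-(Q : ℤ)) < relativeError q x (D.decode (outputVector A x))}

end

/-! The indices are split into `m = M * k` blocks, the residue classes mod `m`, with one measurement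
per block. In the sum of its block the entry `x i` is multiplied by `1 + i * I`, so if `i` is the
only non-zero position of the block, the ratio of imaginary to real part reveals `i` and the real
part is `x i`. The input-node of the block decodes alone and sends one quantized value to one
output-node.

Errors. Quantization costs at most `δ ^ q` per non-zero entry. Collisions cost at most a constant
times the excess `k - (number of blocks hit)` (`sum_decoding_error_le`). For a uniform support, the
events that two given blocks are missed are negatively correlated, so the number of missed blocks
has variance at most `m`, and a second-order Bonferroni bound gives its mean. By Chebyshev the
excess is above `ε * k` with probability `O(m / k ^ 2) = O(1 / k)` (`card_many_emptyFibers_le`).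
Only the support is used here, so the law of the values is irrelevant. Outside this event and the
event of small `ℓ_q` mass, the relative error is at most `2 ^ (-Q)`.

Cost. A block and its input-node fill one lattice cell of side about `√(n / m)`. On any data each
input-node writes to at most one output-node, with boundedly many bits, so the bit-meters are `O(m *
√(n / m)) = O(√(n * k))` (`blockCircuit_bitMetersOn_le`). -/

/-! ### Blocks missed by a uniform `k`-subset -/

theorem one_sub_pow_le_quadratic {y : ℝ} (h0 : 0 ≤ y) (h1 : y ≤ 1) (k : ℕ) :
    (1 - y) ^ k ≤ 1 - k * y + (k * y) ^ 2 / 2 := by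
  induction k with
  | zero => simp
  | succ k ih =>
    rw [pow_succ]
    have h2 := mul_le_mul_of_nonneg_right ih (sub_nonneg.2 h1)
    have h3 : 0 ≤ (k : ℝ) ^ 2 * y ^ 3 := by positivity
    push_cast
    nlinarith [sq_nonneg y]

/-- The inequality holds factor by factor; once `N + k` exceeds `n`, truncated subtraction makes the
new left factor `0`. -/
theorem descFactorial_sub_mul_pow_le (n N k : ℕ) :
    (n - N).descFactorial k * n ^ k ≤ (n - N) ^ k * n.descFactorial k := by
  induction k with
  | zero => simp
  | succ k ih =>
    have key : (n - N - k) * n ≤ (n - N) * (n - k) := by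
      rcases le_total (N + k) n with h | h
      · obtain ⟨d, rfl⟩ := Nat.exists_eq_add_of_le h
        have e1 : N + k + d - N - k = d := by omega
        have e2 : N + k + d - N = k + d := by omega
        have e3 : N + k + d - k = N + d := by omega
        rw [e1, e2, e3]; nlinarith [Nat.zero_le (N * k)]
      · have : n - N - k = 0 := by omega
        simp [this]
    rw [Nat.descFactorial_succ, Nat.descFactorial_succ, pow_succ, pow_succ]
    calc _ = ((n - N - k) * n) * ((n - N).descFactorial k * n ^ k) := by ring
      _ ≤ ((n - N) * (n - k)) * ((n - N) ^ k * n.descFactorial k) := Nat.mul_le_mul key ih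
      _ = _ := by ring

theorem descFactorial_sub_add_mul_le (n N N' k : ℕ) :
    (n - (N + N')).descFactorial k * n.descFactorial k ≤
      (n - N).descFactorial k * (n - N').descFactorial k := by
  induction k with
  | zero => simp
  | succ k ih =>
    have key : (n - (N + N') - k) * (n - k) ≤ (n - N - k) * (n - N' - k) := by
      rcases le_total (N + N' + k) n with h | h
      · obtain ⟨d, rfl⟩ := Nat.exists_eq_add_of_le h
        have e1 : N + N' + k + d - (N + N') - k = d := by omega
        have e2 : N + N' + k + d - k = N + N' + d := by omega
        have e3 : N + N' + k + d - N - k = N' + d := by omega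
        have e4 : N + N' + k + d - N' - k = N + d := by omega
        rw [e1, e2, e3, e4]; nlinarith [Nat.zero_le (N * N')]
      · have : n - (N + N') - k = 0 := by omega
        simp [this]
    simp only [Nat.descFactorial_succ]
    calc _ = ((n - (N + N') - k) * (n - k)) *
          ((n - (N + N')).descFactorial k * n.descFactorial k) := by ring
      _ ≤ ((n - N - k) * (n - N' - k)) *
          ((n - N).descFactorial k * (n - N').descFactorial k) := Nat.mul_le_mul key ih
      _ = _ := by ring

/-- Sampling without replacement avoids a set of size `N` with probability at most `(1 - N / n) ^
k`, the value for sampling with replacement. -/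
theorem choose_sub_mul_pow_le (n N k : ℕ) :
    (n - N).choose k * n ^ k ≤ (n - N) ^ k * n.choose k := by
  have h := descFactorial_sub_mul_pow_le n N k
  simp only [Nat.descFactorial_eq_factorial_mul_choose] at h
  refine Nat.le_of_mul_le_mul_left (?_ : k.factorial * _ ≤ k.factorial * _) k.factorial_pos
  linarith

/-- Negative correlation: for disjoint sets of sizes `N` and `N'`, avoiding one makes avoiding the
other no more likely. -/
theorem choose_sub_add_mul_le (n N N' k : ℕ) :
    (n - (N + N')).choose k * n.choose k ≤ (n - N).choose k * (n - N').choose k := by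
  have h := descFactorial_sub_add_mul_le n N N' k
  simp only [Nat.descFactorial_eq_factorial_mul_choose] at h
  refine Nat.le_of_mul_le_mul_left (?_ : (k.factorial * k.factorial) * _ ≤
    (k.factorial * k.factorial) * _) (Nat.mul_pos k.factorial_pos k.factorial_pos)
  linarith

open Classical in
theorem card_powersetCard_filter_disjoint {α : Type*} [Fintype α] (k : ℕ) (T : Finset α) :
    ((Finset.powersetCard k (Finset.univ : Finset α)).filter (fun S => Disjoint S T)).card =
      (Fintype.card α - T.card).choose k := by
  rw [← Finset.card_compl, ← Finset.card_powersetCard]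
  congr 1
  ext S
  simp only [Finset.mem_filter, Finset.mem_powersetCard, Finset.subset_univ, true_and]
  rw [Finset.subset_compl_iff_disjoint_right, and_comm]

/-- The number of fibres of `f` that miss `S`. -/
noncomputable def emptyFibers {α : Type*} {m : ℕ} (f : α → Fin m) (S : Finset α) : ℕ :=
  open Classical in (Finset.univ.filter (fun b => ∀ i ∈ S, f i ≠ b)).card

section
open Classical

variable {α : Type*} [Fintype α] {m : ℕ} (f : α → Fin m)

theorem emptyFibers_eq_sum (S : Finset α) :
    (emptyFibers f S : ℝ) =
      ∑ b, if Disjoint S (Finset.univ.filter (fun i => f i = b)) then (1 : ℝ) else 0 := by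
  rw [emptyFibers, ← Finset.sum_boole]
  refine Finset.sum_congr rfl fun b _ => ?_
  congr 1
  simp [Finset.disjoint_left]

theorem sum_indicator_disjoint (k : ℕ) (T : Finset α) :
    ∑ S ∈ Finset.powersetCard k (Finset.univ : Finset α),
      (if Disjoint S T then (1 : ℝ) else 0) = (Fintype.card α - T.card).choose k := by
  rw [Finset.sum_boole, card_powersetCard_filter_disjoint]

/-- Chebyshev's inequality for the number of fibres missed by a uniform `k`-subset. -/
theorem card_emptyFibers_deviation (k : ℕ) (hk : k ≤ Fintype.card α) {t : ℝ} (ht : 0 < t) :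
    (((Finset.powersetCard k (Finset.univ : Finset α)).filter (fun S =>
      (∑ b, ((Fintype.card α - (Finset.univ.filter (fun i => f i = b)).card).choose k : ℝ)) /
        (Fintype.card α).choose k + t ≤ emptyFibers f S)).card : ℝ) ≤
      (Fintype.card α).choose k * (m / t ^ 2) := by
  set n := Fintype.card α with hn
  set F : Fin m → Finset α := fun b => Finset.univ.filter (fun i => f i = b) with hF
  set c : Fin m → ℝ := fun b => ((n - (F b).card).choose k : ℝ) with hc
  set Ω := Finset.powersetCard k (Finset.univ : Finset α) with hΩ
  set X : Finset α → ℝ := fun S => (emptyFibers f S : ℝ) with hX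
  set C : ℝ := (n.choose k : ℝ) with hC
  have hCpos : 0 < C := by
    rw [hC]; exact_mod_cast Nat.choose_pos hk
  have hcardΩ : (Ω.card : ℝ) = C := by
    rw [hΩ, Finset.card_powersetCard, Finset.card_univ]
  have h1 : ∑ S ∈ Ω, X S = ∑ b, c b := by
    simp only [hX, emptyFibers_eq_sum]
    rw [Finset.sum_comm]
    exact Finset.sum_congr rfl fun b _ => sum_indicator_disjoint k _
  have hcle : ∀ b, c b ≤ C := fun b => by
    simp only [hc, hC]; exact_mod_cast Nat.choose_le_choose k (Nat.sub_le _ _)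
  have hc0 : ∀ b, 0 ≤ c b := fun b => by simp only [hc]; positivity
  have h2 : ∑ S ∈ Ω, X S ^ 2 ≤ (∑ b, c b) ^ 2 / C + m * C := by
    have e : ∀ S, X S ^ 2 = ∑ b, ∑ b', if Disjoint S (F b ∪ F b') then (1 : ℝ) else 0 := by
      intro S
      simp only [hX, emptyFibers_eq_sum, sq, Finset.sum_mul_sum]
      refine Finset.sum_congr rfl fun b _ => Finset.sum_congr rfl fun b' _ => ?_
      simp only [Finset.disjoint_union_right, ite_and, ite_mul, one_mul, zero_mul]
      rfl
    simp only [e]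
    rw [Finset.sum_comm]
    -- Distinct fibres are disjoint, so negative correlation bounds the off-diagonal terms; each of
    -- the `m` diagonal terms is at most `C`. Hence the variance is at most `m`.
    have e2 : ∀ b b', ∑ S ∈ Ω, (if Disjoint S (F b ∪ F b') then (1 : ℝ) else 0) ≤
        c b * c b' / C + if b = b' then C else 0 := by
      intro b b'
      rw [sum_indicator_disjoint]
      by_cases hb : b = b'
      · subst hb
        have := hcle b
        have h3 : 0 ≤ c b * c b / C := div_nonneg (mul_nonneg (hc0 b) (hc0 b)) hCpos.le
        simp only [Finset.union_idempotent, if_true]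
        change c b ≤ _
        linarith
      · have hd : Disjoint (F b) (F b') := by
          simp only [hF, Finset.disjoint_left, Finset.mem_filter, Finset.mem_univ, true_and]
          rintro i rfl h; exact hb h
        rw [Finset.card_union_of_disjoint hd, if_neg hb, add_zero, le_div_iff₀ hCpos]
        simp only [hc, hC]
        exact_mod_cast choose_sub_add_mul_le n _ _ k
    calc _ = ∑ b, ∑ b', ∑ S ∈ Ω, (if Disjoint S (F b ∪ F b') then (1 : ℝ) else 0) :=
          Finset.sum_congr rfl fun b _ => Finset.sum_comm
      _ ≤ ∑ b, ∑ b', (c b * c b' / C + if b = b' then C else 0) :=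
          Finset.sum_le_sum fun b _ => Finset.sum_le_sum fun b' _ => e2 b b'
      _ = _ := by
          simp [Finset.sum_add_distrib, sq, Finset.sum_mul_sum, Finset.sum_div]
  set μ : ℝ := (∑ b, c b) / C with hμ
  have h3 : ∑ S ∈ Ω, (X S - μ) ^ 2 ≤ m * C := by
    have : ∑ S ∈ Ω, (X S - μ) ^ 2 = ∑ S ∈ Ω, X S ^ 2 - 2 * μ * ∑ S ∈ Ω, X S + Ω.card * μ ^ 2 := by
      simp only [sub_sq, Finset.sum_add_distrib, Finset.sum_sub_distrib, Finset.sum_const,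
        nsmul_eq_mul, Finset.mul_sum]
      congr 2
      exact Finset.sum_congr rfl fun _ _ => by ring
    rw [this, h1, hcardΩ]
    have e3 : ∑ b, c b = μ * C := by rw [hμ]; field_simp
    rw [e3] at h2 ⊢
    have e4 : (μ * C) ^ 2 / C = μ ^ 2 * C := by field_simp
    rw [e4] at h2
    nlinarith
  have h4 : ((Ω.filter (fun S => μ + t ≤ X S)).card : ℝ) * t ^ 2 ≤ ∑ S ∈ Ω, (X S - μ) ^ 2 := by
    rw [← nsmul_eq_mul, ← Finset.sum_const]
    refine (Finset.sum_le_sum fun S hS => ?_).trans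
      (Finset.sum_le_sum_of_subset_of_nonneg (Finset.filter_subset _ _) fun S _ _ => sq_nonneg _)
    have := (Finset.mem_filter.1 hS).2
    nlinarith
  rw [mul_div_assoc', le_div_iff₀ (by positivity)]
  linarith

theorem sum_choose_compl_fiber_le (k : ℕ) (hk : k ≤ Fintype.card α) (hn : 0 < Fintype.card α)
    {r : ℝ} (hr : ∀ b, (k : ℝ) * (Finset.univ.filter (fun i => f i = b)).card ≤
      r * Fintype.card α) :
    (∑ b, ((Fintype.card α - (Finset.univ.filter (fun i => f i = b)).card).choose k : ℝ)) /
        (Fintype.card α).choose k ≤ m - k + k * r / 2 := by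
  set n := Fintype.card α with hn'
  set F : Fin m → Finset α := fun b => Finset.univ.filter (fun i => f i = b) with hF
  have hn0 : (0 : ℝ) < n := by exact_mod_cast hn
  have hsum : ∑ b, ((F b).card : ℝ) = n := by
    rw [hn', ← Finset.card_univ, Finset.card_eq_sum_card_fiberwise (f := f) (t := Finset.univ)]
    · push_cast; rfl
    · intro _ _; simp
  have hC : (0 : ℝ) < n.choose k := by exact_mod_cast Nat.choose_pos hk
  have hb : ∀ b, ((n - (F b).card).choose k : ℝ) / n.choose k ≤
      1 - k * ((F b).card / n) + k * ((F b).card / n) * (r / 2) := by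
    intro b
    have hle : (F b).card ≤ n := Finset.card_le_univ _
    have hle' : ((F b).card : ℝ) ≤ n := by exact_mod_cast hle
    have h1 : ((n - (F b).card).choose k : ℝ) / n.choose k ≤ (1 - (F b).card / n) ^ k := by
      have := choose_sub_mul_pow_le n (F b).card k
      have h' : ((n - (F b).card).choose k : ℝ) * n ^ k ≤
          ((n : ℝ) - (F b).card) ^ k * n.choose k := by
        rw [← Nat.cast_sub hle]; exact_mod_cast this
      have e : (1 - ((F b).card : ℝ) / n) = (n - (F b).card) / n := by field_simp
      rw [e, div_pow, div_le_div_iff₀ hC (by positivity)]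
      exact h'
    have h2 := one_sub_pow_le_quadratic (y := (F b).card / n) (by positivity)
      ((div_le_one hn0).2 hle') k
    -- One factor of the quadratic term is bounded by `r`; the other stays, because the proportions
    -- `(F b).card / n` sum to `1`.
    have h3 : (k : ℝ) * ((F b).card / n) ≤ r := by
      rw [mul_div_assoc', div_le_iff₀ hn0]; exact hr b
    have h4 : 0 ≤ (k : ℝ) * ((F b).card / n) := by positivity
    nlinarith
  rw [Finset.sum_div]
  refine (Finset.sum_le_sum fun b _ => hb b).trans (le_of_eq ?_)
  rw [Finset.sum_add_distrib, Finset.sum_sub_distrib, ← Finset.sum_mul, ← Finset.mul_sum,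
    ← Finset.sum_div, hsum, div_self hn0.ne']
  simp
  ring

/-- A uniform `k`-subset rarely misses substantially more than `m - k` fibres. -/
theorem card_many_emptyFibers_le (k : ℕ) (hk : k ≤ Fintype.card α) (hk0 : 0 < k)
    {ε : ℝ} (hε : 0 < ε) (hr : ∀ b, (k : ℝ) * (Finset.univ.filter (fun i => f i = b)).card ≤
      ε * Fintype.card α) :
    (((Finset.powersetCard k (Finset.univ : Finset α)).filter (fun S =>
      (m : ℝ) - k + ε * k < emptyFibers f S)).card : ℝ) ≤
      (Fintype.card α).choose k * (m / (ε * k / 2) ^ 2) := by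
  have hk' : (0 : ℝ) < k := by exact_mod_cast hk0
  refine le_trans ?_ (card_emptyFibers_deviation f k hk (t := ε * k / 2) (by positivity))
  have h := sum_choose_compl_fiber_le f k hk (hk0.trans_le hk) hr
  refine Nat.cast_le.2 (Finset.card_le_card (Finset.monotone_filter_right _ fun S _ hS => ?_))
  linarith

end

/-! ### Layout in the lattice -/

/-- The point with coordinates `(g / s, g % s)` in the frame `u, v`: consecutive runs of `s ^ 2`
indices fill consecutive `s × s` cells. -/
noncomputable def cellPoint (u v : Plane) (s g : ℕ) : Plane := (g / s) • u + (g % s) • v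

theorem cellPoint_injective {u v : Plane} (huv : LinearIndependent ℝ ![u, v]) (s : ℕ) :
    Function.Injective (cellPoint u v s) := by
  intro g h e
  have e' : (((g / s : ℕ) : ℝ) - ((h / s : ℕ) : ℝ)) • u +
      (((g % s : ℕ) : ℝ) - ((h % s : ℕ) : ℝ)) • v = 0 := by
    simp only [cellPoint, ← Nat.cast_smul_eq_nsmul ℝ] at e
    rw [sub_smul, sub_smul]
    rw [← sub_eq_zero] at e
    rw [← e]; abel
  obtain ⟨h1, h2⟩ := LinearIndependent.pair_iff.1 huv _ _ e'
  have h1' : g / s = h / s := by exact_mod_cast sub_eq_zero.1 h1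
  have h2' : g % s = h % s := by exact_mod_cast sub_eq_zero.1 h2
  rw [← Nat.div_add_mod g s, ← Nat.div_add_mod h s, h1', h2']

theorem cellPoint_mem {Λ : AddSubgroup Plane} {u v : Plane} (hu : u ∈ Λ) (hv : v ∈ Λ) (s g : ℕ) :
    cellPoint u v s g ∈ Λ :=
  add_mem (nsmul_mem hu _) (nsmul_mem hv _)

theorem abs_natCast_sub_le {a b c s : ℕ} (h1 : c ≤ a) (h2 : a ≤ c + s) (h3 : c ≤ b)
    (h4 : b ≤ c + s) : |(a : ℝ) - b| ≤ s := by
  have h1' : (c : ℝ) ≤ a := by exact_mod_cast h1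
  have h2' : (a : ℝ) ≤ c + s := by exact_mod_cast h2
  have h3' : (c : ℝ) ≤ b := by exact_mod_cast h3
  have h4' : (b : ℝ) ≤ c + s := by exact_mod_cast h4
  rw [abs_le]; constructor <;> linarith

/-- A run starting at a multiple of `s ^ 2` stays in one cell: its first coordinates lie between `b
* s` and `b * s + s`, its second ones below `s`. -/
theorem dist_cellPoint_le (u v : Plane) {s : ℕ} (hs : 0 < s) (b : ℕ) {r r' : ℕ}
    (hr : r < s ^ 2) (hr' : r' < s ^ 2) :
    dist (cellPoint u v s (b * s ^ 2 + r)) (cellPoint u v s (b * s ^ 2 + r')) ≤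
      s * (‖u‖ + ‖v‖) := by
  have hdiv : ∀ t, (b * s ^ 2 + t) / s = b * s + t / s := fun t => by
    rw [show b * s ^ 2 + t = t + s * (b * s) by ring, Nat.add_mul_div_left _ _ hs, add_comm]
  have hlt : ∀ t, t < s ^ 2 → t / s ≤ s := fun t ht => by
    rw [sq] at ht; exact (Nat.div_lt_of_lt_mul ht).le
  have h1 : |(((b * s ^ 2 + r) / s : ℕ) : ℝ) - (((b * s ^ 2 + r') / s : ℕ) : ℝ)| ≤ s := by
    rw [hdiv, hdiv]
    exact abs_natCast_sub_le (c := b * s) (Nat.le_add_right _ _) (Nat.add_le_add_left (hlt r hr) _)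
      (Nat.le_add_right _ _) (Nat.add_le_add_left (hlt r' hr') _)
  have h2 : |(((b * s ^ 2 + r) % s : ℕ) : ℝ) - (((b * s ^ 2 + r') % s : ℕ) : ℝ)| ≤ s :=
    abs_natCast_sub_le (c := 0) (Nat.zero_le _) (by simpa using (Nat.mod_lt _ hs).le)
      (Nat.zero_le _) (by simpa using (Nat.mod_lt _ hs).le)
  rw [dist_eq_norm]
  have e : cellPoint u v s (b * s ^ 2 + r) - cellPoint u v s (b * s ^ 2 + r') =
      ((((b * s ^ 2 + r) / s : ℕ) : ℝ) - (((b * s ^ 2 + r') / s : ℕ) : ℝ)) • u +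
      ((((b * s ^ 2 + r) % s : ℕ) : ℝ) - (((b * s ^ 2 + r') % s : ℕ) : ℝ)) • v := by
    simp only [cellPoint, ← Nat.cast_smul_eq_nsmul ℝ, sub_smul]
    abel
  rw [e]
  refine (norm_add_le _ _).trans ?_
  rw [norm_smul, norm_smul, Real.norm_eq_abs, Real.norm_eq_abs, mul_add]
  gcongr

theorem IsRhoLattice.exists_linearIndependent_pair {ρ : ℝ} {Λ : AddSubgroup Plane}
    (h : IsRhoLattice ρ Λ) : ∃ u ∈ Λ, ∃ v ∈ Λ, LinearIndependent ℝ ![u, v] := by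
  have hdim : Module.finrank ℝ Plane = 2 := by simp
  obtain ⟨u, hu, hu0⟩ : ∃ u ∈ Λ, u ≠ 0 := by
    by_contra! hc
    have h1 : Submodule.span ℝ (Λ : Set Plane) = ⊥ := Submodule.span_eq_bot.2 hc
    have h2 := congrArg (fun W : Submodule ℝ Plane => Module.finrank ℝ W)
      (h1.symm.trans h.span_eq_top)
    simp [hdim] at h2
  obtain ⟨v, hv, hvu⟩ : ∃ v ∈ Λ, v ∉ Submodule.span ℝ {u} := by
    by_contra! hc
    have h1 : (⊤ : Submodule ℝ Plane) ≤ Submodule.span ℝ {u} :=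
      h.span_eq_top ▸ Submodule.span_le.2 hc
    have h2 := Submodule.finrank_mono h1
    rw [finrank_top, hdim, finrank_span_singleton hu0] at h2
    omega
  refine ⟨u, hu, v, hv, ?_⟩
  rw [LinearIndependent.pair_iff' hu0]
  intro a ha
  exact hvu (Submodule.mem_span_singleton.2 ⟨a, ha⟩)

/-! ### Quantization and the error within one block -/

/-- The level of the clipped real number `x` on the grid of mesh `δ` in `[-V, V]`. -/
noncomputable def quantLevel (V δ x : ℝ) : ℕ := ⌊(max (-V) (min x V) + V) / δ⌋₊

/-- The grid point in `[-V, V]` representing `x`. -/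
noncomputable def quantValue (V δ x : ℝ) : ℝ := quantLevel V δ x * δ - V

theorem quantLevel_le {V δ : ℝ} (hδ : 0 < δ) (x : ℝ) :
    (quantLevel V δ x : ℝ) ≤ (max (-V) (min x V) + V) / δ :=
  Nat.floor_le (div_nonneg (by linarith [le_max_left (-V) (min x V)]) hδ.le)

/-- Thanks to the clipping, this bounds message lengths even on data that no admissible input
produces. -/
theorem quantLevel_le_const {V δ : ℝ} (hV : 0 ≤ V) (hδ : 0 < δ) (x : ℝ) :
    (quantLevel V δ x : ℝ) ≤ 2 * V / δ := by
  refine (quantLevel_le hδ x).trans (div_le_div_of_nonneg_right ?_ hδ.le)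
  have : max (-V) (min x V) ≤ V := max_le (by linarith) (min_le_right _ _)
  linarith

theorem abs_quantValue_le {V δ : ℝ} (hV : 0 ≤ V) (hδ : 0 < δ) (x : ℝ) : |quantValue V δ x| ≤ V := by
  have h1 := (le_div_iff₀ hδ).1 (quantLevel_le_const hV hδ x)
  have h2 : 0 ≤ (quantLevel V δ x : ℝ) * δ := by positivity
  rw [quantValue, abs_le]; constructor <;> linarith

theorem abs_sub_quantValue_le {V δ : ℝ} (hδ : 0 < δ) {x : ℝ}
    (hx : |x| ≤ V) : |x - quantValue V δ x| ≤ δ := by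
  obtain ⟨hx1, hx2⟩ := abs_le.1 hx
  have h1 := (le_div_iff₀ hδ).1 (quantLevel_le (V := V) hδ x)
  have h2 := (div_lt_iff₀ hδ).1 (Nat.lt_floor_add_one ((max (-V) (min x V) + V) / δ))
  rw [← quantLevel] at h2
  rw [min_eq_left hx2, max_eq_right hx1] at h1 h2
  rw [quantValue, abs_le]; constructor <;> linarith

/-- The value of coordinate `j` recovered from the measurement `y`: if `y` is a real multiple of the
`j`-th direction `1 + j * I`, the quantized coefficient, and zero otherwise. -/
noncomputable def directionValue (V δ : ℝ) (y : ℂ) (j : ℕ) : ℝ :=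
  open Classical in if y.re ≠ 0 ∧ y.im = j * y.re then quantValue V δ y.re else 0

/-- The error on one block of coordinates sharing a measurement. If the block holds one non-zero
coordinate, then it is recovered; otherwise at most one coordinate is wrongly declared non-zero. -/
theorem sum_block_error_le {n : ℕ} (T : Finset (Fin n)) (x : Fin n → ℝ) {V δ q : ℝ} (hV : 0 ≤ V)
    (hδ : 0 < δ) (hq : 0 < q) (hx : ∀ i, |x i| ≤ V) {y : ℂ} (hre : y.re = ∑ i ∈ T, x i)
    (him : y.im = ∑ i ∈ T, (i : ℝ) * x i) :
    ∑ j ∈ T, |x j - directionValue V δ y j| ^ q ≤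
      (T.filter (fun i => x i ≠ 0)).card * δ ^ q +
        3 * (2 * V) ^ q * ((T.filter (fun i => x i ≠ 0)).card -
          if (T.filter (fun i => x i ≠ 0)) = ∅ then 0 else 1) := by
  classical
  set R := T.filter (fun i => x i ≠ 0) with hR
  have hre' : y.re = ∑ i ∈ R, x i := by rw [hre, hR, Finset.sum_filter_ne_zero]
  have him' : y.im = ∑ i ∈ R, (i : ℝ) * x i := by
    rw [him, hR, Finset.sum_filter]
    refine Finset.sum_congr rfl fun i _ => ?_
    by_cases h : x i = 0 <;> simp [h]
  have hxT : ∀ j ∈ T, j ∉ R → x j = 0 := fun j hj hjR => by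
    by_contra h; exact hjR (Finset.mem_filter.2 ⟨hj, h⟩)
  have hδq : 0 ≤ δ ^ q := by positivity
  have hVq : 0 ≤ (2 * V) ^ q := by positivity
  rcases Nat.lt_trichotomy R.card 1 with h | h | h
  · have hR0 : R = ∅ := by rw [← Finset.card_eq_zero]; omega
    rw [Finset.sum_eq_zero]
    · simp [hR0]
    · intro j hj
      have : y.re = 0 := by simp [hre', hR0]
      rw [directionValue, if_neg (by simp [this]), hxT j hj (by simp [hR0])]
      simp [hq.ne']
  · obtain ⟨i, hi⟩ := Finset.card_eq_one.1 h
    have hiR : i ∈ R := by simp [hi]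
    obtain ⟨hiT, hi0⟩ := Finset.mem_filter.1 hiR
    have e1 : y.re = x i := by simp [hre', hi]
    have e2 : y.im = i * x i := by simp [him', hi]
    rw [Finset.sum_eq_single_of_mem i hiT]
    · rw [directionValue, if_pos ⟨by rwa [e1], by rw [e2, e1]⟩, e1, h]
      have := Real.rpow_le_rpow (abs_nonneg _) (abs_sub_quantValue_le hδ (hx i)) hq.le
      simp [hi]
      exact this
    · intro j hj hji
      have : ¬ (y.re ≠ 0 ∧ y.im = j * y.re) := by
        rintro ⟨-, h2⟩
        rw [e1, e2] at h2
        have := mul_right_cancel₀ hi0 h2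
        exact hji (Fin.ext (by exact_mod_cast this.symm))
      rw [directionValue, if_neg this, hxT j hj (by simp [hi, hji])]
      simp [hq.ne']
  -- With `r ≥ 2` non-zero entries, at most `r + 1` coordinates are wrong: those entries and the
  -- single index in `W`, if any. Each contributes at most `(2 * V) ^ q`, and `r + 1 ≤ 3 * (r - 1)`,
  -- whence the factor `3`.
  · set W := T.filter (fun j : Fin n => y.re ≠ 0 ∧ y.im = (j : ℝ) * y.re) with hW
    have hW1 : W.card ≤ 1 := by
      rw [Finset.card_le_one]
      intro a ha b hb
      obtain ⟨-, ha0, ha'⟩ := Finset.mem_filter.1 ha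
      obtain ⟨-, -, hb'⟩ := Finset.mem_filter.1 hb
      have := mul_right_cancel₀ ha0 (ha'.symm.trans hb')
      exact Fin.ext (by exact_mod_cast this)
    have hterm : ∀ j ∈ T, |x j - directionValue V δ y j| ^ q ≤
        (if x j ≠ 0 then (2 * V) ^ q else 0) +
          if y.re ≠ 0 ∧ y.im = (j : ℝ) * y.re then (2 * V) ^ q else 0 := by
      intro j hj
      have hb : |x j - directionValue V δ y j| ≤ 2 * V := by
        have h1 : |directionValue V δ y j| ≤ V := by
          rw [directionValue]
          split_ifs
          · exact abs_quantValue_le hV hδ _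
          · simpa using hV
        have := abs_sub (x j) (directionValue V δ y j)
        linarith [hx j]
      have hb' := Real.rpow_le_rpow (abs_nonneg _) hb hq.le
      by_cases h1 : x j ≠ 0
      · rw [if_pos h1]
        refine hb'.trans (le_add_of_nonneg_right ?_)
        split_ifs <;> [exact hVq; exact le_rfl]
      · by_cases h2 : y.re ≠ 0 ∧ y.im = (j : ℝ) * y.re
        · rw [if_neg h1, if_pos h2, zero_add]; exact hb'
        · rw [if_neg h1, if_neg h2, directionValue, if_neg h2, not_not.1 h1]
          simp [hq.ne']
    refine (Finset.sum_le_sum hterm).trans ?_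
    rw [Finset.sum_add_distrib, ← Finset.sum_filter, ← Finset.sum_filter, Finset.sum_const,
      Finset.sum_const, nsmul_eq_mul, nsmul_eq_mul, if_neg (by rintro h0; simp [h0] at h)]
    change (R.card : ℝ) * _ + (W.card : ℝ) * _ ≤ _
    have h2 : (2 : ℝ) ≤ R.card := by exact_mod_cast h
    have h3 : (W.card : ℝ) ≤ 1 := by exact_mod_cast hW1
    have h4 : 0 ≤ (R.card : ℝ) * δ ^ q := by positivity
    nlinarith

/-! ### The block code and its circuit -/

/-- The block of an index, for `m` blocks formed by the residue classes. -/
def residueBlock {m n : ℕ} (hm : 0 < n → 0 < m) (i : Fin n) : Fin m :=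
  ⟨i % m, Nat.mod_lt _ (hm (by have := i.2; omega))⟩

theorem card_residueBlock_fiber_le {m n : ℕ} (hm : 0 < n → 0 < m) (b : Fin m) :
    (Finset.univ.filter (fun i => residueBlock hm i = b)).card ≤ n / m + 1 := by
  have hinj : Set.InjOn (fun i : Fin n => (i : ℕ) / m)
      (Finset.univ.filter (fun i => residueBlock hm i = b)) := by
    intro i hi j hj hij
    simp only [Finset.coe_filter, Finset.mem_univ, true_and, Set.mem_ofPred_eq] at hi hj
    have h1 : (i : ℕ) % m = j % m := congrArg Fin.val (hi.trans hj.symm)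
    refine Fin.ext ?_
    rw [← Nat.div_add_mod (i : ℕ) m, ← Nat.div_add_mod (j : ℕ) m, h1]
    congr 2
  rw [← Finset.card_image_of_injOn hinj, ← Finset.card_range (n / m + 1)]
  refine Finset.card_le_card fun t ht => ?_
  obtain ⟨i, -, rfl⟩ := Finset.mem_image.1 ht
  exact Finset.mem_range.2 (Nat.lt_succ_of_le (Nat.div_le_div_right i.2.le))

/-- Each row sums one block, the entry with index `i` pointing in the direction `1 + i * I`. -/
noncomputable def blockMatrix {m n : ℕ} (hm : 0 < n → 0 < m) : Matrix (Fin m) (Fin n) ℂ :=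
  fun b i => if residueBlock hm i = b then ⟨1, (i : ℝ)⟩ else 0

section
variable {m n : ℕ} (hm : 0 < n → 0 < m)

theorem outputVector_blockMatrix (x : Fin n → ℝ) (b : Fin m) :
    outputVector (blockMatrix hm) x b =
      ∑ i ∈ Finset.univ.filter (fun i => residueBlock hm i = b), (⟨x i, (i : ℝ) * x i⟩ : ℂ) := by
  rw [outputVector, Matrix.mulVec, dotProduct, Finset.sum_filter]
  refine Finset.sum_congr rfl fun i _ => ?_
  rw [blockMatrix]
  split_ifs
  · apply Complex.ext <;> simp
  · simp

-- Summed over blocks, the excess (non-zero entries, less one if there are any) is the size of the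
-- support minus the number of blocks it hits.
open Classical in
theorem sum_decoding_error_le (x : Fin n → ℝ) {V δ q : ℝ} (hV : 0 ≤ V)
    (hδ : 0 < δ) (hq : 0 < q) (hx : ∀ i, |x i| ≤ V) :
    ∑ j, |x j - directionValue V δ (outputVector (blockMatrix hm) x (residueBlock hm j)) j| ^ q ≤
      (Finset.univ.filter (fun i => x i ≠ 0)).card * δ ^ q +
        3 * (2 * V) ^ q * ((Finset.univ.filter (fun i => x i ≠ 0)).card -
          (m - emptyFibers (residueBlock hm) (Finset.univ.filter (fun i => x i ≠ 0)))) := by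
  set S := Finset.univ.filter (fun i => x i ≠ 0) with hS
  set F : Fin m → Finset (Fin n) := fun b => Finset.univ.filter (fun i => residueBlock hm i = b)
    with hF
  set y := outputVector (blockMatrix hm) x with hy
  have hsum : ∀ g : Fin n → ℝ, ∑ j, g j = ∑ b, ∑ j ∈ F b, g j := fun g =>
    (Finset.sum_fiberwise Finset.univ (residueBlock hm) g).symm
  have hblock : ∀ b, ∑ j ∈ F b, |x j - directionValue V δ (y (residueBlock hm j)) j| ^ q ≤
      ((F b).filter (fun i => x i ≠ 0)).card * δ ^ q +
        3 * (2 * V) ^ q * (((F b).filter (fun i => x i ≠ 0)).card -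
          if ((F b).filter (fun i => x i ≠ 0)) = ∅ then 0 else 1) := by
    intro b
    refine le_trans (le_of_eq ?_) (sum_block_error_le (F b) x hV hδ hq hx (y := y b) ?_ ?_)
    · refine Finset.sum_congr rfl fun j hj => ?_
      rw [(Finset.mem_filter.1 hj).2]
    · rw [hy, outputVector_blockMatrix, Complex.re_sum]
    · rw [hy, outputVector_blockMatrix, Complex.im_sum]
  rw [hsum]
  refine (Finset.sum_le_sum fun b _ => hblock b).trans (le_of_eq ?_)
  have hcard : ∑ b, (((F b).filter (fun i => x i ≠ 0)).card : ℝ) = S.card := by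
    have h1 : ∀ b, (((F b).filter (fun i => x i ≠ 0)).card : ℝ) =
        ∑ j ∈ F b, if x j ≠ 0 then (1 : ℝ) else 0 := fun b => by rw [Finset.sum_boole]
    simp only [h1]
    rw [← hsum, Finset.sum_boole]
  have hempty : ∑ b, (if ((F b).filter (fun i => x i ≠ 0)) = ∅ then (0 : ℝ) else 1) =
      m - emptyFibers (residueBlock hm) S := by
    have h1 : ∀ b, (if ((F b).filter (fun i => x i ≠ 0)) = ∅ then (0 : ℝ) else 1) =
        1 - if ∀ i ∈ S, residueBlock hm i ≠ b then 1 else 0 := by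
      intro b
      have : ((F b).filter (fun i => x i ≠ 0)) = ∅ ↔ ∀ i ∈ S, residueBlock hm i ≠ b := by
        simp only [hF, hS, Finset.filter_eq_empty_iff, Finset.mem_filter, Finset.mem_univ,
          true_and]
        exact ⟨fun h i hi hb => h hb hi, fun h i hb hi => h i hi hb⟩
      by_cases h : ((F b).filter (fun i => x i ≠ 0)) = ∅
      · rw [if_pos h, if_pos (this.1 h), sub_self]
      · rw [if_neg h, if_neg (mt this.2 h), sub_zero]
    simp only [h1]
    rw [Finset.sum_sub_distrib, Finset.sum_boole, emptyFibers]
    simp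
  rw [Finset.sum_add_distrib, ← Finset.sum_mul, ← Finset.mul_sum, Finset.sum_sub_distrib, hcard,
    hempty]

/-- The string sent by an input-node to an output-node of its block: the quantized coefficient in
unary, provided that the stored entry points in the direction of that output-node. -/
noncomputable def blockMessage (V δ : ℝ) :
    CircuitNode m n → CircuitNode m n → ℂ → List Bool
  | Sum.inl b, Sum.inr j, y =>
      open Classical in
      if residueBlock hm j = b ∧ y.re ≠ 0 ∧ y.im = (j : ℝ) * y.re then
        List.replicate (quantLevel V δ y.re + 1) true
      else []
  | _, _, _ => []

open Classical in
theorem length_blockMessage (V δ : ℝ) (b : Fin m) (j : Fin n) (y : ℂ) :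
    (blockMessage hm V δ (Sum.inl b) (Sum.inr j) y).length =
      if residueBlock hm j = b ∧ y.re ≠ 0 ∧ y.im = (j : ℝ) * y.re then
        quantLevel V δ y.re + 1 else 0 := by
  rw [blockMessage]
  split_ifs <;> simp

/-- The index of the lattice cell of a node. -/
def cellIndex (m n s : ℕ) : CircuitNode m n → ℕ
  | Sum.inl b => b * s ^ 2 + 0
  | Sum.inr j => (j % m : ℕ) * s ^ 2 + (j / m + 1)

theorem Nat.eq_and_eq_of_mul_add_eq {a b r r' t : ℕ} (hr : r < t) (hr' : r' < t)
    (h : a * t + r = b * t + r') : a = b ∧ r = r' := by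
  have ht : 0 < t := by omega
  have h1 := congrArg (· / t) h
  have h2 := congrArg (· % t) h
  simp only [mul_comm _ t,
    Nat.mul_add_div ht, Nat.div_eq_of_lt hr, Nat.div_eq_of_lt hr', add_zero,
    Nat.mul_add_mod, Nat.mod_eq_of_lt hr, Nat.mod_eq_of_lt hr'] at h1 h2
  exact ⟨h1, h2⟩

theorem div_succ_lt_sq {m n s : ℕ} (hs : n / m + 1 < s ^ 2) (j : Fin n) :
    (j : ℕ) / m + 1 < s ^ 2 :=
  (Nat.succ_le_succ (Nat.div_le_div_right j.2.le)).trans_lt hs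

theorem cellIndex_injective {s : ℕ} (hs : n / m + 1 < s ^ 2) :
    Function.Injective (cellIndex m n s) := by
  have hs0 : 0 < s ^ 2 := Nat.zero_lt_of_lt hs
  rintro (b | i) (b' | j) h
  · exact congrArg _ (Fin.ext (Nat.eq_and_eq_of_mul_add_eq hs0 hs0 h).1)
  · exact absurd (Nat.eq_and_eq_of_mul_add_eq hs0 (div_succ_lt_sq hs j) h).2 (Nat.succ_ne_zero _).symm
  · exact absurd (Nat.eq_and_eq_of_mul_add_eq (div_succ_lt_sq hs i) hs0 h).2 (Nat.succ_ne_zero _)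
  · obtain ⟨h1, h2⟩ := Nat.eq_and_eq_of_mul_add_eq (div_succ_lt_sq hs i) (div_succ_lt_sq hs j) h
    refine congrArg _ (Fin.ext ?_)
    rw [← Nat.div_add_mod (i : ℕ) m, ← Nat.div_add_mod (j : ℕ) m, h1, Nat.succ.inj h2]

/-- The circuit in which every input-node decodes its block on its own, and notifies the output-node
of the coordinate which it found. -/
noncomputable def blockCircuit {Λ : AddSubgroup Plane} {u v : Plane} (hu : u ∈ Λ) (hv : v ∈ Λ)
    (huv : LinearIndependent ℝ ![u, v]) {s : ℕ} (hs : n / m + 1 < s ^ 2) (V δ : ℝ) :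
    DecodingCircuit Λ m n where
  substrate := Set.range fun w => cellPoint u v s (cellIndex m n s w)
  isCompact_substrate := (Set.finite_range _).isCompact
  loc w := cellPoint u v s (cellIndex m n s w)
  loc_injective := (cellPoint_injective huv s).comp (cellIndex_injective hs)
  loc_mem w := ⟨cellPoint_mem hu hv s _, Set.mem_range_self w⟩
  horizon := 1
  slot _ _ := 0
  message w w' y _ := blockMessage hm V δ w w' y
  recover _ r :=
    if ∑ w, (r w).length = 0 then 0 else ((∑ w, (r w).length - 1 : ℕ) : ℝ) * δ - V
  recover_silent _ := by simp

variable {Λ : AddSubgroup Plane} {u v : Plane} (hu : u ∈ Λ) (hv : v ∈ Λ)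
    (huv : LinearIndependent ℝ ![u, v]) {s : ℕ} (hs : n / m + 1 < s ^ 2) (V δ : ℝ)

theorem blockCircuit_transcript (y : Fin m → ℂ) (w w' : CircuitNode m n) :
    (blockCircuit hm hu hv huv hs V δ).transcript y 1 w w' =
      blockMessage hm V δ w w' (Sum.elim y (fun _ => 0) w) := by
  simp [DecodingCircuit.transcript, blockCircuit]

/-- Only the input-node of the block of `j` can write to `j`, so the total length received is the
length of that one string. The extra unary bit separates level `0` from silence. -/
theorem blockCircuit_decode (y : Fin m → ℂ) (j : Fin n) :
    (blockCircuit hm hu hv huv hs V δ).decode y j =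
      directionValue V δ (y (residueBlock hm j)) j := by
  classical
  have h1 : ∑ w, ((blockCircuit hm hu hv huv hs V δ).transcript y 1 w (Sum.inr j)).length =
      if (y (residueBlock hm j)).re ≠ 0 ∧
        (y (residueBlock hm j)).im = (j : ℝ) * (y (residueBlock hm j)).re then
        quantLevel V δ (y (residueBlock hm j)).re + 1 else 0 := by
    have h2 : ∀ i, (blockMessage hm V δ (Sum.inr i) (Sum.inr j) 0).length = 0 := fun _ => rfl
    simp only [blockCircuit_transcript, Fintype.sum_sum_type, Sum.elim_inl, Sum.elim_inr,
      length_blockMessage, h2, Finset.sum_const_zero, add_zero]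
    rw [Finset.sum_eq_single (residueBlock hm j)]
    · exact if_congr (and_iff_right rfl) rfl rfl
    · intro b _ hb
      exact if_neg fun h' => hb h'.1.symm
    · simp
  change (if ∑ w, ((blockCircuit hm hu hv huv hs V δ).transcript y 1 w (Sum.inr j)).length = 0
    then (0 : ℝ) else ((∑ w, ((blockCircuit hm hu hv huv hs V δ).transcript y 1 w
      (Sum.inr j)).length - 1 : ℕ) : ℝ) * δ - V) = _
  rw [h1, directionValue]
  by_cases h2 : (y (residueBlock hm j)).re ≠ 0 ∧
      (y (residueBlock hm j)).im = (j : ℝ) * (y (residueBlock hm j)).re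
  · rw [if_pos h2, if_pos h2, if_neg (Nat.succ_ne_zero _), Nat.add_sub_cancel]
    rfl
  · rw [if_neg h2, if_neg h2, if_pos rfl]

/-- For arbitrary `y`, the conditions `re ≠ 0` and `im = j * re` determine `j`, so each input-node
uses at most one link, and that link lies within one cell. -/
theorem blockCircuit_bitMetersOn_le (hV : 0 ≤ V) (hδ : 0 < δ) (y : Fin m → ℂ) :
    (blockCircuit hm hu hv huv hs V δ).bitMetersOn y Finset.univ ≤
      m * ((2 * V / δ + 1) * (s * (‖u‖ + ‖v‖))) := by
  classical
  set D := blockCircuit hm hu hv huv hs V δ with hD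
  have hs0 : 0 < s := by
    rcases Nat.eq_zero_or_pos s with rfl | h
    · simp at hs
    · exact h
  set len : CircuitNode m n → CircuitNode m n → ℝ := fun w w' =>
    ((blockMessage hm V δ w w' (Sum.elim y (fun _ => 0) w)).length : ℝ) with hlen
  have h1 : D.bitMetersOn y Finset.univ = ∑ w, ∑ w', len w w' * dist (D.loc w) (D.loc w') := by
    have hb : ∀ w w', (D.bits y w w' : ℝ) = len w w' + len w' w := fun w w' => by
      rw [DecodingCircuit.bits]
      change (((D.transcript y 1 w w').length + (D.transcript y 1 w' w).length : ℕ) : ℝ) = _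
      rw [hD, blockCircuit_transcript, blockCircuit_transcript]
      push_cast; rfl
    have hsw : ∑ w, ∑ w', len w' w * dist (D.loc w) (D.loc w') =
        ∑ w, ∑ w', len w w' * dist (D.loc w) (D.loc w') := by
      rw [Finset.sum_comm]
      exact Finset.sum_congr rfl fun w _ => Finset.sum_congr rfl fun w' _ => by rw [dist_comm]
    -- Each directed message is counted at both orderings of its pair, which cancels the division by
    -- `2`.
    simp only [DecodingCircuit.bitMetersOn, hb, ← Finset.sum_div, add_mul, Finset.sum_add_distrib]
    rw [hsw]; ring
  have h2 : ∑ w, ∑ w', len w w' * dist (D.loc w) (D.loc w') =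
      ∑ b : Fin m, ∑ j : Fin n, len (Sum.inl b) (Sum.inr j) *
        dist (D.loc (Sum.inl b)) (D.loc (Sum.inr j)) := by
    simp [Fintype.sum_sum_type, hlen, blockMessage]
  rw [h1, h2]
  set B := (2 * V / δ + 1) * (s * (‖u‖ + ‖v‖)) with hB
  have hB0 : 0 ≤ B := by positivity
  have h3 : ∀ b : Fin m, ∑ j : Fin n, len (Sum.inl b) (Sum.inr j) *
      dist (D.loc (Sum.inl b)) (D.loc (Sum.inr j)) ≤ B := by
    intro b
    have hterm : ∀ j : Fin n, len (Sum.inl b) (Sum.inr j) *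
        dist (D.loc (Sum.inl b)) (D.loc (Sum.inr j)) ≤
        if residueBlock hm j = b ∧ (y b).re ≠ 0 ∧ (y b).im = (j : ℝ) * (y b).re then B else 0 := by
      intro j
      simp only [hlen, length_blockMessage, Sum.elim_inl]
      split_ifs with h
      · refine mul_le_mul ?_ ?_ dist_nonneg (by positivity)
        · push_cast
          linarith [quantLevel_le_const hV hδ (y b).re]
        · have hj : ((j : ℕ) % m) = b := congrArg Fin.val h.1
          have := dist_cellPoint_le u v hs0 b (r := 0) (by positivity) (div_succ_lt_sq hs j)
          rw [← hj] at this
          change dist (cellPoint u v s (b * s ^ 2 + 0))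
            (cellPoint u v s ((j % m : ℕ) * s ^ 2 + (j / m + 1))) ≤ _
          rw [← hj]
          exact this
      · simp
    refine (Finset.sum_le_sum fun j _ => hterm j).trans ?_
    rw [← Finset.sum_filter, Finset.sum_const, nsmul_eq_mul]
    refine (mul_le_mul_of_nonneg_right ?_ hB0).trans (one_mul B).le
    have : (Finset.univ.filter (fun j : Fin n => residueBlock hm j = b ∧ (y b).re ≠ 0 ∧
        (y b).im = (j : ℝ) * (y b).re)).card ≤ 1 := by
      rw [Finset.card_le_one]
      intro i hi j hj
      obtain ⟨-, -, h0, hi'⟩ := Finset.mem_filter.1 hi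
      obtain ⟨-, -, -, hj'⟩ := Finset.mem_filter.1 hj
      have := mul_right_cancel₀ h0 (hi'.symm.trans hj')
      exact Fin.ext (by exact_mod_cast this)
    exact_mod_cast this
  refine (Finset.sum_le_sum fun b _ => h3 b).trans ?_
  simp

end

/-! ### From the error sum to the block error probability -/

theorem relativeError_le_of_sum_le {n : ℕ} {q : ℝ≥0∞} (hq : 0 < q.toReal) {x z : Fin n → ℝ}
    {θ : ℝ} (hθ : 0 ≤ θ)
    (h : ∑ i, |x i - z i| ^ q.toReal ≤ θ ^ q.toReal * ∑ i, |x i| ^ q.toReal) :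
    relativeError q x z ≤ θ := by
  have hS : 0 ≤ ∑ i, |x i| ^ q.toReal := Finset.sum_nonneg fun i _ => by positivity
  have hD : 0 ≤ ∑ i, |x i - z i| ^ q.toReal := Finset.sum_nonneg fun i _ => by positivity
  rw [relativeError, PiLp.norm_eq_sum hq, PiLp.norm_eq_sum hq]
  simp only [Pi.sub_apply, Real.norm_eq_abs]
  refine div_le_of_le_mul₀ (by positivity) hθ ?_
  refine (Real.rpow_le_rpow hD h (by positivity)).trans (le_of_eq ?_)
  rw [Real.mul_rpow (by positivity) hS, ← Real.rpow_mul hθ, mul_one_div, div_self hq.ne',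
    Real.rpow_one]

section
open Classical

/-- An event which forces an atypical support is as rare as the atypical supports. -/
theorem IsSparseInput.measureReal_le {n k : ℕ} {U : ℝ} {P : Measure (Fin n → ℝ)}
    (hP : IsSparseInput k U P) {E G : Set (Fin n → ℝ)} (B : Finset (Finset (Fin n)))
    (hB : ∀ S ∈ B, S.card = k)
    (h : ∀ x : Fin n → ℝ, (∀ i, |x i| ≤ U) → (Finset.univ.filter (fun i => x i ≠ 0)).card = k →
      x ∈ E → x ∈ G ∨ Finset.univ.filter (fun i => x i ≠ 0) ∈ B) :
    P.real E ≤ P.real G + B.card / n.choose k := by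
  have := hP.isProbabilityMeasure
  set T : Finset (Fin n) → Set (Fin n → ℝ) := fun S => {x | ∀ i, x i ≠ 0 ↔ i ∈ S} with hT
  have hsub : E ≤ᵐ[P] (G ∪ ⋃ S ∈ B, T S : Set _) := by
    filter_upwards [hP.bounded, hP.sparse] with x hx1 hx2 hxE
    have hc : (Finset.univ.filter (fun i => x i ≠ 0)).card = k := by
      rw [← hx2, ← Set.ncard_coe_finset]; congr 1; ext; simp
    rcases h x hx1 hc hxE with h1 | h1
    · exact Or.inl h1
    · refine Or.inr (Set.mem_iUnion₂.2 ⟨_, h1, ?_⟩)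
      simp [hT]
  calc P.real E ≤ P.real (G ∪ ⋃ S ∈ B, T S) :=
        ENNReal.toReal_mono (measure_ne_top _ _) (measure_mono_ae hsub)
    _ ≤ P.real G + P.real (⋃ S ∈ B, T S) := measureReal_union_le _ _
    _ ≤ P.real G + ∑ S ∈ B, P.real (T S) := by
        gcongr; exact measureReal_biUnion_finset_le _ _
    _ = P.real G + B.card / n.choose k := by
        congr 1
        rw [Finset.sum_congr rfl (g := fun _ => ((n.choose k : ℕ) : ℝ)⁻¹), Finset.sum_const,
          nsmul_eq_mul, div_eq_mul_inv]
        intro S hS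
        rw [Measure.real, hP.uniform S (hB S hS)]
        simp

theorem blockErrorProb_blockCircuit_le {m n k : ℕ} (hm : 0 < n → 0 < m) {Λ : AddSubgroup Plane}
    {u v : Plane} (hu : u ∈ Λ) (hv : v ∈ Λ) (huv : LinearIndependent ℝ ![u, v]) {s : ℕ}
    (hs : n / m + 1 < s ^ 2) {q : ℝ≥0∞} (hq : 0 < q.toReal) {Q : ℕ} {c U δ ε : ℝ} (hδ : 0 < δ)
    (hε : 0 < ε) (hδc : δ ^ q.toReal ≤ ((2 : ℝ) ^ (-(Q : ℤ))) ^ q.toReal * c / 2)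
    (hεc : 3 * (2 * |U|) ^ q.toReal * ε ≤ ((2 : ℝ) ^ (-(Q : ℤ))) ^ q.toReal * c / 2)
    (hk0 : 0 < k) (hkn : k ≤ n) (hN : (k : ℝ) * ((n / m : ℕ) + 1) ≤ ε * n)
    {P : Measure (Fin n → ℝ)} (hP : IsSparseInput k U P) :
    blockErrorProb q Q P (blockMatrix hm) (blockCircuit hm hu hv huv hs |U| δ) ≤
      P.real {x | ∑ i, |x i| ^ q.toReal < c * (k : ℝ)} + m / (ε * k / 2) ^ 2 := by
  set f := residueBlock hm with hf
  set B := (Finset.powersetCard k (Finset.univ : Finset (Fin n))).filter (fun S =>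
      (m : ℝ) - k + ε * k < emptyFibers f S) with hB
  have hC : (0 : ℝ) < n.choose k := by exact_mod_cast Nat.choose_pos hkn
  have hBcard : (B.card : ℝ) / n.choose k ≤ m / (ε * k / 2) ^ 2 := by
    rw [div_le_iff₀ hC, mul_comm]
    have := card_many_emptyFibers_le f k (by simpa using hkn) hk0 hε (fun b => by
      have h1 : ((Finset.univ.filter (fun i => f i = b)).card : ℝ) ≤ (n / m : ℕ) + 1 := by
        have := card_residueBlock_fiber_le hm b
        exact_mod_cast this
      rw [Fintype.card_fin]
      exact (mul_le_mul_of_nonneg_left h1 (Nat.cast_nonneg k)).trans hN)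
    simpa only [Fintype.card_fin] using this
  refine (hP.measureReal_le B (fun S hS =>
    (Finset.mem_powersetCard.1 (Finset.mem_filter.1 hS).1).2) ?_).trans
    (add_le_add_right hBcard _)
  intro x hxU hxk hxE
  by_contra hcon
  rw [not_or] at hcon
  obtain ⟨hG, hxB⟩ := hcon
  set S := Finset.univ.filter (fun i => x i ≠ 0) with hS
  have hG' : c * k ≤ ∑ i, |x i| ^ q.toReal := not_lt.1 hG
  have hX : (emptyFibers f S : ℝ) ≤ m - k + ε * k := by
    by_contra hlt
    exact hxB (Finset.mem_filter.2
      ⟨Finset.mem_powersetCard.2 ⟨Finset.subset_univ _, hxk⟩, not_le.1 hlt⟩)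
  have hxE' : (2 : ℝ) ^ (-(Q : ℤ)) < relativeError q x
    ((blockCircuit hm hu hv huv hs |U| δ).decode (outputVector (blockMatrix hm) x)) := hxE
  refine absurd hxE' (not_lt.2 (relativeError_le_of_sum_le hq (by positivity) ?_))
  simp only [blockCircuit_decode]
  refine (sum_decoding_error_le hm x (abs_nonneg U) hδ hq
    (fun i => (hxU i).trans (le_abs_self U))).trans ?_
  rw [← hS, ← hf, hxk]
  set W := (2 * |U|) ^ q.toReal with hW
  set θ := ((2 : ℝ) ^ (-(Q : ℤ))) ^ q.toReal with hθ
  have hW0 : 0 ≤ W := by positivity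
  have hθ0 : 0 ≤ θ := by positivity
  have hk : (0 : ℝ) ≤ k := Nat.cast_nonneg k
  -- The error budget `θ * c * k` is shared equally between quantization and collisions.
  calc (k : ℝ) * δ ^ q.toReal + 3 * W * (k - (m - emptyFibers f S))
      ≤ k * δ ^ q.toReal + 3 * W * (ε * k) := by gcongr; linarith
    _ = k * (δ ^ q.toReal + 3 * W * ε) := by ring
    _ ≤ k * (θ * c / 2 + θ * c / 2) := by gcongr
    _ = θ * (c * k) := by ring
    _ ≤ _ := by gcongr

end

/-! ### Choice of parameters and asymptotics -/

theorem sparsity_pos {β : ℝ} (hβ1 : β < 1) {n : ℕ} (hn : 0 < n) : 0 < sparsity β n := by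
  refine Nat.floor_pos.2 (Real.one_le_rpow ?_ (by linarith))
  exact_mod_cast hn

theorem eventually_sparsity_le_mul {β : ℝ} (hβ0 : 0 < β) {r : ℝ} (hr : 0 < r) :
    ∀ᶠ n : ℕ in atTop, (sparsity β n : ℝ) ≤ r * n := by
  have h := ((tendsto_rpow_neg_atTop hβ0).comp tendsto_natCast_atTop_atTop).eventually
    (eventually_le_nhds hr)
  filter_upwards [h, eventually_gt_atTop 0] with n hn hn0
  have hn0' : (0 : ℝ) < n := by exact_mod_cast hn0
  refine (Nat.floor_le (by positivity)).trans ?_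
  rw [sub_eq_neg_add, Real.rpow_add hn0', Real.rpow_one]
  exact mul_le_mul_of_nonneg_right hn hn0'.le

/-- There are `m` cells of side about `√(n / m)`. Since `n / m ≥ 1`, the root is at most `2 * √(n /
m)` and the rounding `1` at most `√(n / m)`, whence `3`. -/
theorem mul_sqrt_div_succ_le {m n : ℕ} (hm : 0 < m) (hmn : m ≤ n) :
    (m : ℝ) * ((Nat.sqrt (n / m + 1) + 1 : ℕ) : ℝ) ≤ 3 * √((n : ℝ) * m) := by
  have hm' : (0 : ℝ) < m := by exact_mod_cast hm
  have hmn' : (m : ℝ) ≤ n := by exact_mod_cast hmn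
  have ha : (1 : ℝ) ≤ n / m := (one_le_div hm').2 hmn'
  have h1 : (Nat.sqrt (n / m + 1) : ℝ) ≤ 2 * √((n : ℝ) / m) := by
    refine Real.nat_sqrt_le_real_sqrt.trans ?_
    rw [show (2 : ℝ) = √4 by rw [show (4 : ℝ) = 2 ^ 2 by norm_num]; simp,
      ← Real.sqrt_mul (by norm_num)]
    refine Real.sqrt_le_sqrt ?_
    have : ((n / m : ℕ) : ℝ) ≤ n / m := Nat.cast_div_le
    push_cast
    linarith
  have h2 : 1 ≤ √((n : ℝ) / m) := Real.one_le_sqrt.2 ha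
  have h3 : (m : ℝ) * √((n : ℝ) / m) = √((n : ℝ) * m) := by
    rw [← Real.sqrt_sq hm'.le, ← Real.sqrt_mul (by positivity), Real.sqrt_sq hm'.le]
    congr 1; field_simp
  calc (m : ℝ) * ((Nat.sqrt (n / m + 1) + 1 : ℕ) : ℝ) ≤ m * (3 * √((n : ℝ) / m)) := by
        gcongr; push_cast; linarith
    _ = _ := by rw [← h3]; ring

theorem theorem2 (β : ℝ) (hβ0 : 0 < β) (hβ1 : β < 1)
    (U : ℝ) (q : ℝ≥0∞) (hq0 : q ≠ 0) (hqtop : q ≠ ⊤) (Q : ℕ) (c : ℝ) (hc : 0 < c)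
    (ρ : ℝ) (hρ : 0 < ρ) (Λ : AddSubgroup Plane) (hΛ : IsRhoLattice ρ Λ) :
    ∃ (m : ℕ → ℕ) (A : (n : ℕ) → Matrix (Fin (m n)) (Fin n) ℂ)
      (D : (n : ℕ) → DecodingCircuit Λ (m n) n),
      (∀ P : (n : ℕ) → Measure (Fin n → ℝ),
        (∀ n, IsSparseInput (sparsity β n) U (P n)) →
        (fun n => (P n).real {x | ∑ i, |x i| ^ q.toReal < c * (sparsity β n : ℝ)})
          =O[atTop] (fun n => 1 / √(sparsity β n : ℝ)) →
        (fun n => blockErrorProb q Q (P n) (A n) (D n))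
          =O[atTop] (fun n => 1 / √(sparsity β n : ℝ))) ∧
      (fun n => (m n : ℝ)) =Θ[atTop] (fun n => (sparsity β n : ℝ)) ∧
      ∃ C : ℝ, ∀ᶠ n in atTop,
        (D n).bitMeters ≤ ENNReal.ofReal (C * √((n : ℝ) * (sparsity β n : ℝ))) := by
  obtain ⟨u, hu, v, hv, huv⟩ := hΛ.exists_linearIndependent_pair
  have hq : 0 < q.toReal := ENNReal.toReal_pos hq0 hqtop
  set θ := ((2 : ℝ) ^ (-(Q : ℤ))) ^ q.toReal with hθ
  have hθ0 : 0 < θ := by positivity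
  set W := (2 * |U|) ^ q.toReal with hW
  have hW0 : 0 ≤ W := by positivity
  obtain ⟨δ, hδ, hδc⟩ : ∃ δ : ℝ, 0 < δ ∧ δ ^ q.toReal ≤ θ * c / 2 :=
    ⟨(θ * c / 2) ^ (1 / q.toReal), by positivity, by
      rw [← Real.rpow_mul (by positivity), one_div_mul_cancel hq.ne', Real.rpow_one]⟩
  obtain ⟨ε, hε, hεc⟩ : ∃ ε : ℝ, 0 < ε ∧ 3 * W * ε ≤ θ * c / 2 :=
    -- The `+ 1` covers `W = 0`, that is `U = 0`.
    ⟨θ * c / (6 * W + 1), by positivity, by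
      rw [mul_div_assoc', div_le_div_iff₀ (by positivity) two_pos]
      nlinarith [mul_pos hθ0 hc]⟩
  -- The blocks have at most `n / (M * k) + 1` elements. Multiplied by `k`, the main term is at most
  -- `n / M ≤ ε * n / 2`; the rounding term `k` is eventually at most `ε * n / 2` too, by sparsity.
  obtain ⟨M, hM⟩ := exists_nat_gt (2 / ε)
  have hM0' : (0 : ℝ) < M := (by positivity : (0 : ℝ) < 2 / ε).trans hM
  have hM0 : 0 < M := by exact_mod_cast hM0'
  set k := sparsity β with hk
  -- For `n = 0` the sparsity is `0` and there are no blocks; positivity is needed only when there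
  -- is an index.
  have hm : ∀ n, 0 < n → 0 < M * k n := fun n hn => Nat.mul_pos hM0 (sparsity_pos hβ1 hn)
  have hs : ∀ n, n / (M * k n) + 1 < (Nat.sqrt (n / (M * k n) + 1) + 1) ^ 2 := fun n => by
    rw [sq]; exact Nat.lt_succ_sqrt _
  have hkε := eventually_sparsity_le_mul hβ0 (half_pos hε)
  have hkM := eventually_sparsity_le_mul hβ0 (inv_pos.2 hM0')
  refine ⟨fun n => M * k n, fun n => blockMatrix (hm n),
    fun n => blockCircuit (hm n) hu hv huv (hs n) |U| δ, ?_, ?_, ?_⟩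
  · intro P hP hG
    have hbound : (fun n => (P n).real {x | ∑ i, |x i| ^ q.toReal < c * (k n : ℝ)} +
        ((M * k n : ℕ) : ℝ) / (ε * k n / 2) ^ 2) =O[atTop] (fun n => 1 / √(k n : ℝ)) := by
      -- The collision term equals `4 * M / (ε ^ 2 * k)`, which is even `O(1 / k)`; the rate `1 /
      -- √k` is dictated by the assumption `hG`.
      refine hG.add (IsBigO.of_bound (4 * M / ε ^ 2) ?_)
      filter_upwards [eventually_gt_atTop 0] with n hn
      have hk1 : (1 : ℝ) ≤ k n := by exact_mod_cast sparsity_pos hβ1 hn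
      have hk0 : (0 : ℝ) < k n := by linarith
      have hsq : √(k n : ℝ) ≤ k n := by
        rw [Real.sqrt_le_left hk0.le]; nlinarith
      rw [Real.norm_of_nonneg (by positivity), Real.norm_of_nonneg (by positivity)]
      calc ((M * k n : ℕ) : ℝ) / (ε * k n / 2) ^ 2 = 4 * M / ε ^ 2 * (1 / k n) := by
            push_cast; field_simp; ring
        _ ≤ _ := by gcongr
    refine (IsBigO.of_bound 1 ?_).trans hbound
    filter_upwards [eventually_gt_atTop 0, hkε, hkM] with n hn h1 h2
    have hk0 : 0 < k n := sparsity_pos hβ1 hn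
    have hk0' : (0 : ℝ) < k n := by exact_mod_cast hk0
    have hM1 : (1 : ℝ) ≤ M := by exact_mod_cast hM0
    have hkn : k n ≤ n := by
      have h3 : (M : ℝ)⁻¹ * n ≤ n :=
        mul_le_of_le_one_left (Nat.cast_nonneg n) (inv_le_one_of_one_le₀ hM1)
      exact_mod_cast h2.trans h3
    have hN : (k n : ℝ) * ((n / (M * k n) : ℕ) + 1) ≤ ε * n := by
      have h3 : ((n / (M * k n) : ℕ) : ℝ) ≤ n / ((M * k n : ℕ) : ℝ) := Nat.cast_div_le
      have h4 : (k n : ℝ) * (n / ((M * k n : ℕ) : ℝ)) = n / M := by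
        push_cast; field_simp
      have h5 : (n : ℝ) / M ≤ ε / 2 * n := by
        rw [div_le_iff₀ hM0']
        have := (div_lt_iff₀ hε).1 hM
        nlinarith [(Nat.cast_nonneg n : (0 : ℝ) ≤ n)]
      nlinarith [mul_le_mul_of_nonneg_left h3 hk0'.le]
    rw [one_mul, Real.norm_of_nonneg (by exact measureReal_nonneg)]
    exact (blockErrorProb_blockCircuit_le (hm n) hu hv huv (hs n) hq hδ hε hδc hεc hk0 hkn hN
      (hP n)).trans (le_abs_self _)
  · simp only [Nat.cast_mul]
    exact (isTheta_refl _ _).const_mul_left hM0'.ne'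
  · refine ⟨3 * √M * ((2 * |U| / δ + 1) * (‖u‖ + ‖v‖)), ?_⟩
    filter_upwards [eventually_gt_atTop 0, hkM] with n hn h2
    have hmn : M * k n ≤ n := by
      have h3 := mul_le_mul_of_nonneg_left h2 hM0'.le
      rw [mul_inv_cancel_left₀ hM0'.ne'] at h3
      exact_mod_cast h3
    refine iSup_le fun y => ENNReal.ofReal_le_ofReal ?_
    refine (blockCircuit_bitMetersOn_le (hm n) hu hv huv (hs n) |U| δ (abs_nonneg U) hδ y).trans ?_
    have h3 := mul_sqrt_div_succ_le (hm n hn) hmn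
    have h4 : √((n : ℝ) * (M * k n : ℕ)) = √M * √(n * k n) := by
      rw [← Real.sqrt_mul hM0'.le]; push_cast; congr 1; ring
    rw [h4] at h3
    have h5 : 0 ≤ (2 * |U| / δ + 1) * (‖u‖ + ‖v‖) := by positivity
    calc _ = (((M * k n : ℕ) : ℝ) * ((Nat.sqrt (n / (M * k n) + 1) + 1 : ℕ) : ℝ)) *
          ((2 * |U| / δ + 1) * (‖u‖ + ‖v‖)) := by ring
      _ ≤ _ := mul_le_mul_of_nonneg_right h3 h5
      _ = _ := by ring
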